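/- For $\mathbf x\in\mathbb Z^3$ and $i\in\{1,2,3\}$ let $[\mathbf x,i]^\star=\{\mathbf x+\sum_{j\ne i}\lambda_j\mathbf e_j:\lambda_j\in[0,1]\}\subset\mathbb R^3$ (a face), and call a finite union of faces a pattern. Let $U=[\mathbf 0,1]^\star\cup[\mathbf 0,2]^\star\cup[\mathbf 0,3]^\star$. For $\mathbf v\in\mathbb R^3_{>0}$ the discrete plane $\Gamma_{\mathbf v}$ is the union of all faces $[\mathbf x,i]^\star$ with $0\le\langle\mathbf x,\mathbf v\rangle<\langle\mathbf e_i,\mathbf v\rangle$. For a word $w$ over $\{1,2,3\}$ let $\mathbf P(w)=(|w|_1,|w|_2,|w|_3)$ be the vector of its letter counts. For a substitution $\sigma$ on $\{1,2,3\}$ whose incidence matrix $\mathbf M_\sigma$ (with $i$th column $\mathbf P(\sigma(i))$) has determinant $\pm1$, the dual substitution is $$\mathbf E_1^\star(\sigma)([\mathbf x,i]^\star)=\bigcup_{(p,j,s)\,:\,\sigma(j)=pis}[\mathbf M_\sigma^{-1}(\mathbf x+\mathbf P(s)),j]^\star ,$$ extended to unions of faces by taking unions. Put $\Sigma_i=\mathbf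 E_1^\star(\sigma_i)$, where the Brun substitutions are $$\sigma_1:1\mapsto1,\ 2\mapsto2,\ 3\mapsto32;\qquad \sigma_2:1\mapsto1,\ 2\mapsto3,\ 3\mapsto23;\qquad \sigma_3:1\mapsto2,\ 2\mapsto3,\ 3\mapsto13 .$$ The Brun algorithm maps a vector $\mathbf v=(v_1,v_2,v_3)$ with $0\le v_1\le v_2\le v_3$ to $(v_1,v_2,v_3-v_2)$ if $v_2\le v_3-v_2$ (case 1), to $(v_1,v_3-v_2,v_2)$ if $v_1\le v_3-v_2<v_2$ (case 2), and to $(v_3-v_2,v_1,v_2)$ if $v_3-v_2<v_1$ (case 3). The Brun expansion of $\mathbf v$ is the sequence $(i_n)_{n\ge1}\in\{1,2,3\}^{\mathbb N}$ of the cases met when this map is iterated from $\mathbf v$. A sequence in $\{1,2,3\}^{\mathbb N}$ is Brun-admissible if it contains infinitely many $3$s. **Theorem.** Let $(i_n)_{n\ge1}$ be a Brun-admissible sequence, and let $P_0=U$ and $P_n=\Sigma_{i_1}\cdots\Sigma_{i_n}(U)$ for $n\ge1$. Then $(P_n)_{n\ge0}$ is a strictly increasing sequence of patterns. There is a vector $\mathbf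 v$ with $0\le v_1\le v_2\le v_3$ whose Brun expansion is $(i_n)_{n\ge1}$, and every such $\mathbf v$ satisfies the following. 1. All entries of $\mathbf v$ are positive, and $P_n\subseteq\Gamma_{\mathbf v}$ for every $n\ge0$. 2. $\bigcup_{n\ge0}P_n\subsetneq\Gamma_{\mathbf v}$ if and only if there is $k\ge1$ such that $(i_n)_{n\ge k}$ is the labelling of an infinite backward path $\cdots\xrightarrow{i_{k+1}}\bullet\xrightarrow{i_k}\bullet$ in the directed graph with vertices $a,b,c,d$ and the labelled edges $$b\xrightarrow{1}b,\quad c\xrightarrow{1}c,\quad d\xrightarrow{1}d,\quad d\xrightarrow{2}c,\quad c\xrightarrow{2}d,\quad a\xrightarrow{2}b,\quad a\xrightarrow{3}b,\quad b\xrightarrow{3}d,\quad c\xrightarrow{3}a .$$ -/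

import Mathlib

/-! Letters, face types and coordinates `1, 2, 3` are the elements `0, 1, 2` of `Fin 3`. -/

/-- A substitution on three letters: a non-erasing morphism of the free monoid, given by the images
of the letters. -/
structure Substitution where
  image : Fin 3 → List (Fin 3)
  non_erasing : ∀ a, image a ≠ []

/-- The abelianization `P(w)` of a word: its `a`-th entry is the number of occurrences of `a`. -/
def abelianization (w : List (Fin 3)) : Fin 3 → ℤ := fun a => (w.count a : ℤ)

/-- The incidence matrix: its `b`-th column is the abelianization of the image of `b`. -/
def Substitution.incidence (σ : Substitution) : Matrix (Fin 3) (Fin 3) ℤ :=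
  Matrix.of fun a b => abelianization (σ.image b) a

/-- The pointed face `[x, i]*` with vector `x ∈ ℤ³` and type `i`. -/
@[ext] structure Face where
  vec : Fin 3 → ℤ
  type : Fin 3

/-- The face `[x, i]*` as a subset of `ℝ³`: the unit square `x + ∑_{j ≠ i} [0,1] e_j`. -/
def Face.square (f : Face) : Set (Fin 3 → ℝ) :=
  {y | y f.type = f.vec f.type ∧ ∀ j, j ≠ f.type → (f.vec j : ℝ) ≤ y j ∧ y j ≤ f.vec j + 1}

/-- The union, as a subset of `ℝ³`, of a collection of faces. -/
def region (S : Set Face) : Set (Fin 3 → ℝ) := ⋃ f ∈ S, f.square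

/-- A collection of faces and the union of its faces determine each other. -/
theorem region_subset_region_iff {S T : Set Face} : region S ⊆ region T ↔ S ⊆ T := by
  constructor
  · intro h f hf
    let m : Fin 3 → ℝ := fun j => if j = f.type then f.vec j else f.vec j + 1 / 2
    have hm : m ∈ region S := by
      refine Set.mem_biUnion hf ⟨by simp [m], fun j hj => ?_⟩
      simp only [m, if_neg hj]
      constructor <;> linarith
    obtain ⟨g, hg, h1, h2⟩ := Set.mem_iUnion₂.1 (h hm)
    have ht : g.type = f.type := by
      by_contra hne
      simp only [m, if_neg hne] at h1
      have h3 : (2 * f.vec g.type + 1 : ℤ) = 2 * g.vec g.type := by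
        have : (2 * f.vec g.type + 1 : ℝ) = 2 * g.vec g.type := by linarith
        exact_mod_cast this
      omega
    have hv : g.vec = f.vec := by
      funext j
      by_cases hj : j = g.type
      · subst hj
        simp only [m, if_pos ht] at h1
        exact_mod_cast h1.symm
      · obtain ⟨h3, h4⟩ := h2 j hj
        have hj' : j ≠ f.type := ht ▸ hj
        simp only [m, if_neg hj'] at h3 h4
        have h5 : (2 * g.vec j : ℤ) ≤ 2 * f.vec j + 1 := by
          have : (2 * g.vec j : ℝ) ≤ 2 * f.vec j + 1 := by linarith
          exact_mod_cast this
        have h6 : (2 * f.vec j + 1 : ℤ) ≤ 2 * g.vec j + 2 := by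
          have : (2 * f.vec j + 1 : ℝ) ≤ 2 * g.vec j + 2 := by linarith
          exact_mod_cast this
        omega
    have : g = f := Face.ext hv ht
    exact this ▸ hg
  · exact fun h => Set.biUnion_subset_biUnion_left h

/-- The faces of the discrete plane `Γ_v`: those `[x, i]*` with `0 ≤ ⟨x, v⟩ < ⟨e_i, v⟩`. -/
def discretePlane (v : Fin 3 → ℝ) : Set Face :=
  {f | 0 ≤ ∑ j, (f.vec j : ℝ) * v j ∧ ∑ j, (f.vec j : ℝ) * v j < v f.type}

/-- The faces of the lower half unit cube `U`. -/
def lowerHalfCube : Set Face := {f | f.vec = 0}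

/-- The dual substitution `E₁*(σ)` of a single face `[x, i]*`: all the faces `[M_σ⁻¹ (x + P(s)), j]*`
with `σ(j) = p i s`. -/
noncomputable def Substitution.dualFace (σ : Substitution) (f : Face) : Set Face :=
  {g | ∃ p s : List (Fin 3), σ.image g.type = p ++ f.type :: s ∧
    g.vec = (σ.incidence⁻¹).mulVec (f.vec + abelianization s)}

/-- The dual substitution `E₁*(σ)` of a collection of faces. -/
noncomputable def Substitution.dual (σ : Substitution) (S : Set Face) : Set Face :=
  ⋃ f ∈ S, σ.dualFace f

/-- The symbols `1`, `2`, `3` occurring in Brun expansions. -/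
inductive BrunDigit
  | one
  | two
  | three

/-- The Brun substitutions, `1 ↦ 1, 2 ↦ 2, 3 ↦ 32`, `1 ↦ 1, 2 ↦ 3, 3 ↦ 23` and
`1 ↦ 2, 2 ↦ 3, 3 ↦ 13`. -/
def brunSubstitution : BrunDigit → Substitution
  | .one => ⟨![[0], [1], [2, 1]], by decide⟩
  | .two => ⟨![[0], [2], [1, 2]], by decide⟩
  | .three => ⟨![[1], [2], [0, 2]], by decide⟩

/-- The Brun substitutions are unimodular, so that the inverse matrices above are genuine. -/
theorem isUnit_det_brunSubstitution (d : BrunDigit) :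
    IsUnit (brunSubstitution d).incidence.det := by
  rw [Int.isUnit_iff]
  cases d <;> decide

/-- The domain `0 ≤ v₁ ≤ v₂ ≤ v₃` of the Brun algorithm. -/
def BrunOrdered (v : Fin 3 → ℝ) : Prop := 0 ≤ v 0 ∧ v 0 ≤ v 1 ∧ v 1 ≤ v 2

open Classical in
/-- The case of the Brun algorithm that applies to an ordered vector `v`. -/
noncomputable def brunDigit (v : Fin 3 → ℝ) : BrunDigit :=
  if v 1 ≤ v 2 - v 1 then .one
  else if v 0 ≤ v 2 - v 1 then .two
  else .three

/-- One step of the Brun algorithm: subtract the second largest entry from the largest and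
reorder. -/
noncomputable def brunStep (v : Fin 3 → ℝ) : Fin 3 → ℝ :=
  match brunDigit v with
  | .one => ![v 0, v 1, v 2 - v 1]
  | .two => ![v 0, v 2 - v 1, v 1]
  | .three => ![v 2 - v 1, v 0, v 1]

/-- The Brun expansion of an ordered vector. The term of index `n` of the Lean sequence is the
`(n+1)`-st symbol of the expansion. -/
noncomputable def brunExpansion (v : Fin 3 → ℝ) : ℕ → BrunDigit :=
  fun n => brunDigit (brunStep^[n] v)

/-- A sequence is Brun-admissible if it contains infinitely many `3`s. -/
def BrunAdmissible (i : ℕ → BrunDigit) : Prop := ∀ N, ∃ n, N ≤ n ∧ i n = .three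

/-- The faces of `P_n = Σ_{i_1} ⋯ Σ_{i_n}(U)`, where `i_1, i_2, …` is `i 0, i 1, …`, so that
`P_0 = U` and `P_{n+1}` is the image by `Σ_{i_1}` of the `n`-th pattern of the shifted sequence. -/
noncomputable def brunPattern : (ℕ → BrunDigit) → ℕ → Set Face
  | _, 0 => lowerHalfCube
  | i, n + 1 => (brunSubstitution (i 0)).dual (brunPattern (fun k => i (k + 1)) n)

/-- The vertices of the four-vertex graph. -/
inductive BrunVertex
  | a
  | b
  | c
  | d

/-- `BrunEdge x l y`: the four-vertex graph has an edge from `x` to `y` labelled `l`. -/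
inductive BrunEdge : BrunVertex → BrunDigit → BrunVertex → Prop
  | bb1 : BrunEdge .b .one .b
  | cc1 : BrunEdge .c .one .c
  | dd1 : BrunEdge .d .one .d
  | dc2 : BrunEdge .d .two .c
  | cd2 : BrunEdge .c .two .d
  | ab2 : BrunEdge .a .two .b
  | ab3 : BrunEdge .a .three .b
  | bd3 : BrunEdge .b .three .d
  | ca3 : BrunEdge .c .three .a

/-- The sequence `l` labels an infinite backward path `⋯ → w 2 → w 1 → w 0` of the four-vertex
graph, the edge from `w (n + 1)` to `w n` having the label `l n`. -/
def IsBackwardLabelling (l : ℕ → BrunDigit) : Prop :=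
  ∃ w : ℕ → BrunVertex, ∀ n, BrunEdge (w (n + 1)) (l n) (w n)

/-! Call `f` a parent of `g` when `g` lies in the dual image of `f`. The linear map of a Brun step
is the inverse transpose of the incidence matrix, so heights are preserved when passing from a face
to its parents, up to one shift. That shift cuts the height interval of type `2` into two, one for
each letter of the two-letter image. Hence every face of the plane of `v` has exactly one parent in
the plane of `brunStep v`, and a face lies in the `n`-th pattern exactly when its `n`-th ancestor
lies in the lower half cube. A face is uncovered when its ancestors never get there.

Say that two faces are adjacent if their vectors are at sup-distance at most one. Parents of
adjacent faces are adjacent (`Face.Adjacent.parent`), and adjacency connects the plane. If some face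
is uncovered, then some covered face is adjacent to an uncovered one. Once the ancestors of the
former have entered the half cube, those of the latter stay within distance one of the origin,
outside the half cube, forever.

Only finitely many vectors can occur in such a chain. Some are excluded by a potential that drops at
each digit `3`; the others form the vertices `a, b, c, d`, and passing to a parent follows an edge
backwards. Conversely, faces attached to the vertices turn a backward path into a chain of ancestors
avoiding the half cube.

A vector with a prescribed expansion comes from compactness. Admissibility makes all orderings along
the orbit strict, so the boundary cases between digits never occur. -/

/-! ### The Brun dual substitutions in coordinates -/

/-- The action of the incidence matrix of a Brun substitution. -/
def brunLin : BrunDigit → (Fin 3 → ℤ) → (Fin 3 → ℤ)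
  | .one, x => ![x 0, x 1 + x 2, x 2]
  | .two, x => ![x 0, x 2, x 1 + x 2]
  | .three, x => ![x 2, x 0, x 1 + x 2]

/-- The last letter of the image of a letter by a Brun substitution. -/
def brunLast : BrunDigit → Fin 3 → Fin 3
  | .one => ![0, 1, 1]
  | .two => ![0, 2, 2]
  | .three => ![1, 2, 2]

/-- The first letter of the two-letter image of the third letter by a Brun substitution. -/
def brunFirst : BrunDigit → Fin 3
  | .one => 2
  | .two => 1
  | .three => 0

theorem exists_singleton_eq_append_cons {α : Type*} {a i : α} {Q : List α → Prop} :
    (∃ p s, [a] = p ++ i :: s ∧ Q s) ↔ i = a ∧ Q [] := by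
  constructor
  · rintro ⟨_ | ⟨_, _⟩, s, h, hQ⟩
    · simp only [List.nil_append, List.cons.injEq] at h
      obtain ⟨rfl, rfl⟩ := h
      exact ⟨rfl, hQ⟩
    · simp at h
  · rintro ⟨rfl, h⟩
    exact ⟨[], [], rfl, h⟩

theorem exists_pair_eq_append_cons {α : Type*} {a b i : α} {Q : List α → Prop} :
    (∃ p s, [a, b] = p ++ i :: s ∧ Q s) ↔ (i = b ∧ Q []) ∨ (i = a ∧ Q [b]) := by
  constructor
  · rintro ⟨_ | ⟨_, p⟩, s, h, hQ⟩
    · simp only [List.nil_append, List.cons.injEq] at h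
      obtain ⟨rfl, rfl⟩ := h
      exact Or.inr ⟨rfl, hQ⟩
    · simp only [List.cons_append, List.cons.injEq] at h
      exact Or.inl (exists_singleton_eq_append_cons.1 ⟨p, s, h.2, hQ⟩)
  · rintro (⟨rfl, h⟩ | ⟨rfl, h⟩)
    · exact ⟨[a], [], rfl, h⟩
    · exact ⟨[], [b], rfl, h⟩

theorem brunSubstitution_incidence_mulVec (d : BrunDigit) (x : Fin 3 → ℤ) :
    (brunSubstitution d).incidence.mulVec x = brunLin d x := by
  cases d <;> funext j <;> fin_cases j <;>
    simp [Matrix.mulVec, dotProduct, Fin.sum_univ_three, Substitution.incidence, abelianization,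
      brunSubstitution, brunLin]

theorem eq_incidence_inv_mulVec_iff (d : BrunDigit) (x y : Fin 3 → ℤ) :
    x = ((brunSubstitution d).incidence⁻¹).mulVec y ↔ y = brunLin d x := by
  have hu := isUnit_det_brunSubstitution d
  rw [← brunSubstitution_incidence_mulVec]
  constructor
  · rintro rfl
    rw [Matrix.mulVec_mulVec, Matrix.mul_nonsing_inv _ hu, Matrix.one_mulVec]
  · rintro rfl
    rw [Matrix.mulVec_mulVec, Matrix.nonsing_inv_mul _ hu, Matrix.one_mulVec]

theorem abelianization_singleton (a : Fin 3) : abelianization [a] = Pi.single a 1 := by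
  funext b
  by_cases h : b = a
  · subst h
    simp [abelianization]
  · simp [abelianization, List.count_eq_zero, h]

theorem abelianization_nil : abelianization [] = 0 := by
  funext b
  simp [abelianization]

/-- Only the third letter has a two-letter image, so the suffix `s` is empty, or is the single
letter `brunLast d 2`. Multiplying by the incidence matrix removes the inverse. -/
theorem mem_dualFace_brunSubstitution_iff (d : BrunDigit) (f g : Face) :
    g ∈ (brunSubstitution d).dualFace f ↔
      (f.type = brunLast d g.type ∧ f.vec = brunLin d g.vec) ∨
      (g.type = 2 ∧ f.type = brunFirst d ∧
        f.vec + Pi.single (brunLast d 2) 1 = brunLin d g.vec) := by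
  obtain ⟨x, j⟩ := g
  simp only [Substitution.dualFace, Set.mem_ofPred_eq, eq_incidence_inv_mulVec_iff]
  cases d <;> fin_cases j <;>
    simp [brunSubstitution, brunLast, brunFirst, exists_singleton_eq_append_cons,
      exists_pair_eq_append_cons, abelianization_nil, abelianization_singleton]

theorem Substitution.mem_dual {σ : Substitution} {S : Set Face} {g : Face} :
    g ∈ σ.dual S ↔ ∃ f ∈ S, g ∈ σ.dualFace f := by
  simp [Substitution.dual]

theorem Substitution.finite_dualFace (σ : Substitution) (f : Face) : (σ.dualFace f).Finite := by
  have hfin : (⋃ j : Fin 3, (fun s => (⟨(σ.incidence⁻¹).mulVec (f.vec + abelianization s), j⟩ :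
      Face)) '' {s | s ∈ (σ.image j).tails}).Finite :=
    Set.finite_iUnion fun j => (List.finite_toSet _).image _
  refine hfin.subset ?_
  rintro ⟨x, j⟩ ⟨p, s, h, hx⟩
  refine Set.mem_iUnion.2 ⟨j, s, ?_, ?_⟩
  · rw [Set.mem_ofPred_eq, List.mem_tails]
    exact ⟨p ++ [f.type], by simpa using h.symm⟩
  · exact Face.ext hx.symm rfl

theorem Substitution.finite_dual (σ : Substitution) {S : Set Face} (hS : S.Finite) :
    (σ.dual S).Finite :=
  hS.biUnion fun f _ => σ.finite_dualFace f

theorem finite_lowerHalfCube : lowerHalfCube.Finite := by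
  refine (Set.finite_range fun j : Fin 3 => (⟨0, j⟩ : Face)).subset ?_
  rintro ⟨x, j⟩ h
  exact ⟨j, Face.ext (Eq.symm h) rfl⟩

theorem finite_brunPattern (i : ℕ → BrunDigit) (n : ℕ) : (brunPattern i n).Finite := by
  induction n generalizing i with
  | zero => exact finite_lowerHalfCube
  | succ n ih => exact Substitution.finite_dual _ (ih _)

/-! ### Orbits of the Brun algorithm -/

/-- The linear map applied in a step of the Brun algorithm with a given digit. -/
def brunUnlift : BrunDigit → (Fin 3 → ℝ) → (Fin 3 → ℝ)
  | .one, v => ![v 0, v 1, v 2 - v 1]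
  | .two, v => ![v 0, v 2 - v 1, v 1]
  | .three, v => ![v 2 - v 1, v 0, v 1]

theorem brunStep_eq_brunUnlift (v : Fin 3 → ℝ) : brunStep v = brunUnlift (brunDigit v) v := by
  unfold brunStep
  cases brunDigit v <;> rfl

/-- This is how admissibility enters: a degeneracy that survives the digits `1` and `2` is still
present at the next `3`, where it can be contradicted. -/
theorem BrunAdmissible.exists_three_of_preserved {i : ℕ → BrunDigit} (hi : BrunAdmissible i)
    {p : ℕ → Prop} (hp : ∀ n, i n ≠ .three → p n → p (n + 1)) {n : ℕ} (hn : p n) :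
    ∃ m, n ≤ m ∧ i m = .three ∧ p m := by
  by_contra! h
  have key : ∀ k, p (n + k) := by
    intro k
    induction k with
    | zero => exact hn
    | succ k ih => exact hp (n + k) (fun h3 => h _ (Nat.le_add_right n k) h3 ih) ih
  obtain ⟨m, hm, h3⟩ := hi n
  exact h m hm h3 (by simpa [Nat.add_sub_cancel' hm] using key (m - n))

/-- A sequence of ordered vectors which is obtained by steps of the Brun algorithm, up to
boundary cases in the choice of the digit. -/
structure IsBrunOrbit (i : ℕ → BrunDigit) (u : ℕ → Fin 3 → ℝ) : Prop where
  admissible : BrunAdmissible i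
  ordered : ∀ n, BrunOrdered (u n)
  step : ∀ n, u (n + 1) = brunUnlift (i n) (u n)
  ne_zero : u 0 ≠ 0

namespace IsBrunOrbit

variable {i : ℕ → BrunDigit} {u : ℕ → Fin 3 → ℝ}

theorem ne_zero_of_index (h : IsBrunOrbit i u) (n : ℕ) : u n ≠ 0 := by
  induction n with
  | zero => exact h.ne_zero
  | succ n ih =>
    intro h0
    apply ih
    rw [h.step] at h0
    have e0 := congrFun h0 0
    have e1 := congrFun h0 1
    have e2 := congrFun h0 2
    cases hd : i n <;> simp [hd, brunUnlift] at e0 e1 e2 <;> funext j <;> fin_cases j <;>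
      simp <;> linarith

theorem two_pos (h : IsBrunOrbit i u) (n : ℕ) : 0 < u n 2 := by
  obtain ⟨h0, h1, h2⟩ := h.ordered n
  by_contra hle
  refine h.ne_zero_of_index n ?_
  funext j
  fin_cases j <;> simp <;> linarith

theorem one_pos (h : IsBrunOrbit i u) (n : ℕ) : 0 < u n 1 := by
  by_contra hle
  have hz : u n 1 = 0 := le_antisymm (not_lt.1 hle) ((h.ordered n).1.trans (h.ordered n).2.1)
  obtain ⟨m, -, h3, hm⟩ := h.admissible.exists_three_of_preserved (p := fun n => u n 1 = 0)
    (fun n hn hu => by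
      have hs := h.step n
      have ho := h.ordered (n + 1)
      have hp := h.two_pos n
      simp only [BrunOrdered, hs] at ho
      rw [hs]
      cases hd : i n <;> simp_all [brunUnlift]
      linarith) hz
  have ho := h.ordered (m + 1)
  have hp := h.two_pos m
  have ho' := h.ordered m
  simp only [BrunOrdered, h.step m, h3, brunUnlift, Matrix.cons_val] at ho ho'
  linarith

theorem zero_pos (h : IsBrunOrbit i u) (n : ℕ) : 0 < u n 0 := by
  by_contra hle
  have hz : u n 0 = 0 := le_antisymm (not_lt.1 hle) (h.ordered n).1
  obtain ⟨m, -, h3, hm⟩ := h.admissible.exists_three_of_preserved (p := fun n => u n 0 = 0)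
    (fun n hn hu => by
      rw [h.step n]
      cases hd : i n <;> simp_all [brunUnlift]) hz
  have hp := h.one_pos (m + 1)
  simp [h.step m, h3, brunUnlift, hm] at hp

/-- Equality would make the difference, which is an entry of the next vector, vanish. -/
theorem one_lt_two (h : IsBrunOrbit i u) (n : ℕ) : u n 1 < u n 2 := by
  refine lt_of_le_of_ne (h.ordered n).2.2 fun he => ?_
  have p0 := h.zero_pos (n + 1)
  have p1 := h.one_pos (n + 1)
  have p2 := h.two_pos (n + 1)
  rw [h.step] at p0 p1 p2
  cases hd : i n <;> simp [hd, brunUnlift, he] at p0 p1 p2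

/-- Digit `1` preserves an equality of the two smaller entries; digits `2` and `3` turn it into an
equality of the two larger ones, which `one_lt_two` forbids. -/
theorem zero_lt_one (h : IsBrunOrbit i u) (n : ℕ) : u n 0 < u n 1 := by
  refine lt_of_le_of_ne (h.ordered n).2.1 fun he => ?_
  obtain ⟨m, -, h3, hm⟩ := h.admissible.exists_three_of_preserved (p := fun n => u n 0 = u n 1)
    (fun n hn hu => by
      have hs := h.step n
      have ho := h.ordered (n + 1)
      have hl := h.one_lt_two (n + 1)
      simp only [BrunOrdered, hs] at ho hl
      rw [hs]
      cases hd : i n <;> simp_all [brunUnlift]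
      linarith) he
  have hl := h.one_lt_two (m + 1)
  simp [h.step m, h3, brunUnlift, hm] at hl

theorem brunDigit_eq (h : IsBrunOrbit i u) (n : ℕ) : brunDigit (u n) = i n := by
  have l1 := h.zero_lt_one (n + 1)
  have l2 := h.one_lt_two (n + 1)
  rw [h.step] at l1 l2
  unfold brunDigit
  cases hd : i n <;> simp [hd, brunUnlift] at l1 l2
  · rw [if_pos l2.le]
  · rw [if_neg l2.not_ge, if_pos l1.le]
  · rw [if_neg (by linarith), if_neg l1.not_ge]

theorem brunStep_eq (h : IsBrunOrbit i u) (n : ℕ) : brunStep (u n) = u (n + 1) := by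
  rw [brunStep_eq_brunUnlift, h.brunDigit_eq, h.step]

theorem brunExpansion_eq (h : IsBrunOrbit i u) : brunExpansion (u 0) = i := by
  have key : ∀ n, brunStep^[n] (u 0) = u n := by
    intro n
    induction n with
    | zero => rfl
    | succ n ih => rw [Function.iterate_succ_apply', ih, h.brunStep_eq]
  funext n
  rw [brunExpansion, key, h.brunDigit_eq]

end IsBrunOrbit

/-! ### Vectors with a prescribed expansion -/

/-- The inverse of `brunUnlift d`. -/
def brunLift : BrunDigit → (Fin 3 → ℝ) → (Fin 3 → ℝ)
  | .one, w => ![w 0, w 1, w 1 + w 2]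
  | .two, w => ![w 0, w 2, w 1 + w 2]
  | .three, w => ![w 1, w 2, w 0 + w 2]

theorem brunUnlift_brunLift (d : BrunDigit) (w : Fin 3 → ℝ) : brunUnlift d (brunLift d w) = w := by
  cases d <;> funext j <;> fin_cases j <;> simp [brunUnlift, brunLift]

theorem brunUnlift_smul (d : BrunDigit) (c : ℝ) (w : Fin 3 → ℝ) :
    brunUnlift d (c • w) = c • brunUnlift d w := by
  cases d <;> funext j <;> fin_cases j <;> simp [brunUnlift, mul_sub]

theorem continuous_brunUnlift (d : BrunDigit) : Continuous (brunUnlift d) := by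
  refine continuous_pi fun j => ?_
  cases d <;> fin_cases j <;> simp [brunUnlift] <;> fun_prop

theorem BrunOrdered.smul {v : Fin 3 → ℝ} (h : BrunOrdered v) {c : ℝ} (hc : 0 ≤ c) :
    BrunOrdered (c • v) := by
  obtain ⟨h0, h1, h2⟩ := h
  refine ⟨mul_nonneg hc h0, ?_, ?_⟩ <;> simp only [Pi.smul_apply, smul_eq_mul] <;> gcongr

theorem BrunOrdered.brunLift {w : Fin 3 → ℝ} (h : BrunOrdered w) (d : BrunDigit) :
    BrunOrdered (brunLift d w) := by
  obtain ⟨h0, h1, h2⟩ := h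
  cases d <;> simp [BrunOrdered, _root_.brunLift] <;> refine ⟨?_, ?_, ?_⟩ <;> linarith

theorem isClosed_setOf_brunOrdered : IsClosed {v | BrunOrdered v} := by
  have h1 : Continuous fun v : Fin 3 → ℝ => v 0 := continuous_apply 0
  have h2 : Continuous fun v : Fin 3 → ℝ => v 1 := continuous_apply 1
  have h3 : Continuous fun v : Fin 3 → ℝ => v 2 := continuous_apply 2
  exact (isClosed_le continuous_const h1).inter
    ((isClosed_le h1 h2).inter (isClosed_le h2 h3))

/-- The iterates of a vector under the linear maps given by a sequence of digits. -/
def brunUnlifts (i : ℕ → BrunDigit) (v : Fin 3 → ℝ) : ℕ → Fin 3 → ℝ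
  | 0 => v
  | n + 1 => brunUnlift (i n) (brunUnlifts i v n)

theorem brunUnlifts_succ' (i : ℕ → BrunDigit) (v : Fin 3 → ℝ) (n : ℕ) :
    brunUnlifts i v (n + 1) = brunUnlifts (fun k => i (k + 1)) (brunUnlift (i 0) v) n := by
  induction n with
  | zero => rfl
  | succ n ih => rw [brunUnlifts, ih, brunUnlifts]

theorem brunUnlifts_smul (i : ℕ → BrunDigit) (c : ℝ) (v : Fin 3 → ℝ) (n : ℕ) :
    brunUnlifts i (c • v) n = c • brunUnlifts i v n := by
  induction n with
  | zero => rfl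
  | succ n ih => rw [brunUnlifts, ih, brunUnlift_smul, brunUnlifts]

theorem continuous_brunUnlifts (i : ℕ → BrunDigit) (n : ℕ) :
    Continuous fun v => brunUnlifts i v n := by
  induction n with
  | zero => exact continuous_id
  | succ n ih => exact (continuous_brunUnlift _).comp ih

theorem exists_forall_le_brunOrdered_brunUnlifts (i : ℕ → BrunDigit) (n : ℕ) :
    ∃ v : Fin 3 → ℝ, 0 < v 2 ∧ ∀ m ≤ n, BrunOrdered (brunUnlifts i v m) := by
  induction n generalizing i with
  | zero =>
    -- Any ordered vector with positive last entry would serve as the seed; the inverse branches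
    -- pull it back.
    refine ⟨fun _ => 1, one_pos, fun m hm => ?_⟩
    obtain rfl := Nat.le_zero.1 hm
    exact ⟨zero_le_one, le_rfl, le_rfl⟩
  | succ n ih =>
    obtain ⟨w, hw, h⟩ := ih fun k => i (k + 1)
    obtain ⟨h0, h1, h2⟩ := h 0 (Nat.zero_le _)
    refine ⟨brunLift (i 0) w, ?_, ?_⟩
    · simp only [brunUnlifts] at h0 h1 h2
      cases i 0 <;> simp only [brunLift, Matrix.cons_val] <;> linarith
    · rintro (_ | m) hm
      · exact (h 0 (Nat.zero_le _)).brunLift _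
      · rw [brunUnlifts_succ', brunUnlift_brunLift]
        exact h m (by omega)

theorem exists_brunExpansion_eq {i : ℕ → BrunDigit} (hi : BrunAdmissible i) :
    ∃ v, BrunOrdered v ∧ brunExpansion v = i := by
  -- The `K n` are nested, and closed because only weak inequalities are imposed. The normalization
  -- `v 2 = 1` makes them compact and excludes the zero vector.
  let K : ℕ → Set (Fin 3 → ℝ) := fun n =>
    {v | v 2 = 1 ∧ ∀ m ≤ n, BrunOrdered (brunUnlifts i v m)}
  have hclosed : ∀ n, IsClosed (K n) := by
    intro n
    have : K n = {v | v 2 = 1} ∩ ⋂ m, ⋂ _ : m ≤ n, {v | BrunOrdered (brunUnlifts i v m)} := by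
      ext v
      simp [K]
    rw [this]
    exact (isClosed_eq (continuous_apply 2) continuous_const).inter <|
      isClosed_iInter fun m => isClosed_iInter fun _ =>
        isClosed_setOf_brunOrdered.preimage (continuous_brunUnlifts i m)
  have hcompact : IsCompact (K 0) := by
    refine IsCompact.of_isClosed_subset
      (isCompact_univ_pi fun _ : Fin 3 => isCompact_Icc (a := (0 : ℝ)) (b := 1)) (hclosed 0) ?_
    rintro v ⟨h, ho⟩ j -
    obtain ⟨h0, h1, h2⟩ := ho 0 le_rfl
    simp only [brunUnlifts] at h0 h1 h2
    fin_cases j <;> simp <;> constructor <;> linarith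
  have hne : ∀ n, (K n).Nonempty := by
    intro n
    obtain ⟨v, hv, h⟩ := exists_forall_le_brunOrdered_brunUnlifts i n
    refine ⟨(v 2)⁻¹ • v, by simp [hv.ne'], fun m hm => ?_⟩
    rw [brunUnlifts_smul]
    exact (h m hm).smul (inv_nonneg.2 hv.le)
  obtain ⟨v, hv⟩ := IsCompact.nonempty_iInter_of_sequence_nonempty_isCompact_isClosed K
    (fun n v hv => ⟨hv.1, fun m hm => hv.2 m (by omega)⟩) hne hcompact hclosed
  rw [Set.mem_iInter] at hv
  have horb : IsBrunOrbit i (brunUnlifts i v) :=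
    { admissible := hi
      ordered := fun n => (hv n).2 n le_rfl
      step := fun n => rfl
      ne_zero := fun h0 => by
        have := (hv 0).1
        have h2 := congrFun h0 2
        simp only [brunUnlifts, this, Pi.zero_apply] at h2
        exact one_ne_zero h2 }
  exact ⟨v, horb.ordered 0, horb.brunExpansion_eq⟩

/-! ### Faces of discrete planes and their parents -/

/-- An ordered vector with an admissible Brun expansion. -/
def IsBrunGeneric (v : Fin 3 → ℝ) : Prop := BrunOrdered v ∧ BrunAdmissible (brunExpansion v)

theorem BrunOrdered.brunStep {v : Fin 3 → ℝ} (h : BrunOrdered v) : BrunOrdered (brunStep v) := by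
  obtain ⟨h0, h1, h2⟩ := h
  rw [brunStep_eq_brunUnlift]
  unfold brunDigit BrunOrdered
  split_ifs <;> simp only [brunUnlift, Matrix.cons_val] <;> refine ⟨?_, ?_, ?_⟩ <;> linarith

namespace IsBrunGeneric

variable {v : Fin 3 → ℝ}

theorem brunStep (h : IsBrunGeneric v) : IsBrunGeneric (brunStep v) :=
  ⟨h.1.brunStep, fun N => by
    obtain ⟨n, hn, h3⟩ := h.2 (N + 1)
    obtain ⟨m, rfl⟩ : ∃ m, n = m + 1 := ⟨n - 1, by omega⟩
    exact ⟨m, by omega, h3⟩⟩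

theorem iterate (h : IsBrunGeneric v) (n : ℕ) : IsBrunGeneric (_root_.brunStep^[n] v) := by
  induction n with
  | zero => exact h
  | succ n ih =>
    rw [Function.iterate_succ_apply']
    exact ih.brunStep

theorem isBrunOrbit (h : IsBrunGeneric v) :
    IsBrunOrbit (brunExpansion v) fun n => _root_.brunStep^[n] v where
  admissible := h.2
  ordered n := (h.iterate n).1
  step n := by
    rw [Function.iterate_succ_apply', brunStep_eq_brunUnlift, brunExpansion]
  ne_zero h0 := by
    -- The zero vector is fixed with constant digit `1`, which is not admissible.
    have hd : brunDigit (0 : Fin 3 → ℝ) = .one := by simp [brunDigit]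
    have hs : _root_.brunStep (0 : Fin 3 → ℝ) = 0 := by
      rw [brunStep_eq_brunUnlift, hd]
      funext j
      fin_cases j <;> simp [brunUnlift]
    obtain ⟨n, -, h3⟩ := h.2 0
    have hv : v = 0 := h0
    rw [brunExpansion, hv, Function.iterate_fixed hs, hd] at h3
    cases h3

theorem zero_pos (h : IsBrunGeneric v) : 0 < v 0 := h.isBrunOrbit.zero_pos 0

theorem zero_lt_one (h : IsBrunGeneric v) : v 0 < v 1 := h.isBrunOrbit.zero_lt_one 0

theorem one_lt_two (h : IsBrunGeneric v) : v 1 < v 2 := h.isBrunOrbit.one_lt_two 0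

theorem pos (h : IsBrunGeneric v) (j : Fin 3) : 0 < v j := by
  have h0 := h.zero_pos
  have h1 := h.zero_lt_one
  have h2 := h.one_lt_two
  fin_cases j <;> simp <;> linarith

end IsBrunGeneric

theorem mem_discretePlane {v : Fin 3 → ℝ} {f : Face} : f ∈ discretePlane v ↔
    0 ≤ f.vec 0 * v 0 + f.vec 1 * v 1 + f.vec 2 * v 2 ∧
      f.vec 0 * v 0 + f.vec 1 * v 1 + f.vec 2 * v 2 < v f.type := by
  simp [discretePlane, Fin.sum_univ_three]

theorem lowerHalfCube_subset_discretePlane {v : Fin 3 → ℝ} (hv : ∀ j, 0 < v j) :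
    lowerHalfCube ⊆ discretePlane v := by
  intro f hf
  have hf : f.vec = 0 := hf
  simp [mem_discretePlane, hf, hv]

/-- `IsParent d f g` says that the face `g` belongs to the image of `f` by the dual of the Brun
substitution of digit `d`. -/
def IsParent (d : BrunDigit) (f g : Face) : Prop := g ∈ (brunSubstitution d).dualFace f

theorem isParent_iff {d : BrunDigit} {f g : Face} : IsParent d f g ↔
    (f.type = brunLast d g.type ∧ f.vec = brunLin d g.vec) ∨
      (g.type = 2 ∧ f.type = brunFirst d ∧
        f.vec + Pi.single (brunLast d 2) 1 = brunLin d g.vec) :=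
  mem_dualFace_brunSubstitution_iff d f g

theorem isParent_eq_or {d : BrunDigit} {f g : Face} (h : IsParent d f g) :
    f = ⟨brunLin d g.vec, brunLast d g.type⟩ ∨
      (g.type = 2 ∧ f = ⟨brunLin d g.vec - Pi.single (brunLast d 2) 1, brunFirst d⟩) := by
  rcases isParent_iff.1 h with ⟨h1, h2⟩ | ⟨h1, h2, h3⟩
  · exact Or.inl (Face.ext h2 h1)
  · exact Or.inr ⟨h1, Face.ext (eq_sub_of_add_eq h3) h2⟩

theorem isParent_last (d : BrunDigit) (g : Face) :
    IsParent d ⟨brunLin d g.vec, brunLast d g.type⟩ g :=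
  isParent_iff.2 (Or.inl ⟨rfl, rfl⟩)

theorem isParent_first (d : BrunDigit) {g : Face} (hg : g.type = 2) :
    IsParent d ⟨brunLin d g.vec - Pi.single (brunLast d 2) 1, brunFirst d⟩ g :=
  isParent_iff.2 (Or.inr ⟨hg, rfl, sub_add_cancel _ _⟩)

/-- The height of the integer point `x` in direction `v`. -/
def latticeHeight (x : Fin 3 → ℤ) (v : Fin 3 → ℝ) : ℝ := x 0 * v 0 + x 1 * v 1 + x 2 * v 2

theorem latticeHeight_sub_single (x : Fin 3 → ℤ) (j : Fin 3) (v : Fin 3 → ℝ) :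
    latticeHeight (x - Pi.single j 1) v = latticeHeight x v - v j := by
  fin_cases j <;> simp [latticeHeight] <;> ring

/-- The two linear maps are inverse transposes of each other. -/
theorem latticeHeight_brunLin (d : BrunDigit) (x : Fin 3 → ℤ) (v : Fin 3 → ℝ) :
    latticeHeight (brunLin d x) (brunUnlift d v) = latticeHeight x v := by
  cases d <;> simp [latticeHeight, brunLin, brunUnlift] <;> ring

theorem brunUnlift_brunLast (d : BrunDigit) (v : Fin 3 → ℝ) {j : Fin 3} (hj : j ≠ 2) :
    brunUnlift d v (brunLast d j) = v j := by
  cases d <;> fin_cases j <;> simp_all [brunUnlift, brunLast]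

theorem brunUnlift_brunLast_add_brunFirst (d : BrunDigit) (v : Fin 3 → ℝ) :
    brunUnlift d v (brunLast d 2) + brunUnlift d v (brunFirst d) = v 2 := by
  cases d <;> simp [brunUnlift, brunLast, brunFirst]

theorem mem_discretePlane_iff_latticeHeight {v : Fin 3 → ℝ} {f : Face} : f ∈ discretePlane v ↔
    0 ≤ latticeHeight f.vec v ∧ latticeHeight f.vec v < v f.type :=
  mem_discretePlane

section Parents

variable {v : Fin 3 → ℝ} {f f' g : Face}

theorem exists_isParent_mem_discretePlane (hg : g ∈ discretePlane v) :
    ∃ f ∈ discretePlane (brunStep v), IsParent (brunDigit v) f g := by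
  rw [mem_discretePlane_iff_latticeHeight] at hg
  have hsum := brunUnlift_brunLast_add_brunFirst (brunDigit v) v
  simp only [brunStep_eq_brunUnlift, mem_discretePlane_iff_latticeHeight]
  -- The height of `g` selects the parent: below the threshold the last letter, above it the first
  -- letter of the two-letter image.
  by_cases h : latticeHeight g.vec v < brunUnlift (brunDigit v) v (brunLast (brunDigit v) g.type)
  · exact ⟨_, ⟨by rw [latticeHeight_brunLin]; exact hg.1, by rwa [latticeHeight_brunLin]⟩,
      isParent_last _ _⟩
  · have hj : g.type = 2 := by
      by_contra hj
      exact h (by rw [brunUnlift_brunLast _ _ hj]; exact hg.2)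
    rw [hj] at h hg
    refine ⟨_, ⟨?_, ?_⟩, isParent_first _ hj⟩ <;>
      simp only [latticeHeight_sub_single, latticeHeight_brunLin] <;> linarith

theorem mem_discretePlane_of_isParent (hv : ∀ j, 0 < brunStep v j)
    (hf : f ∈ discretePlane (brunStep v)) (h : IsParent (brunDigit v) f g) :
    g ∈ discretePlane v := by
  have hsum := brunUnlift_brunLast_add_brunFirst (brunDigit v) v
  rw [mem_discretePlane_iff_latticeHeight] at hf ⊢
  rw [brunStep_eq_brunUnlift] at hf hv
  have hfirst := hv (brunFirst (brunDigit v))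
  have hlast := hv (brunLast (brunDigit v) 2)
  rcases isParent_eq_or h with rfl | ⟨hj, rfl⟩
  · simp only [latticeHeight_brunLin] at hf
    refine ⟨hf.1, ?_⟩
    by_cases hj : g.type = 2
    · rw [hj] at hf ⊢
      linarith
    · rw [brunUnlift_brunLast _ _ hj] at hf
      exact hf.2
  · simp only [latticeHeight_sub_single, latticeHeight_brunLin] at hf
    rw [hj]
    constructor <;> linarith

theorem isParent_unique (hf : f ∈ discretePlane (brunStep v))
    (hf' : f' ∈ discretePlane (brunStep v)) (h : IsParent (brunDigit v) f g)
    (h' : IsParent (brunDigit v) f' g) : f = f' := by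
  rw [mem_discretePlane_iff_latticeHeight] at hf hf'
  rw [brunStep_eq_brunUnlift] at hf hf'
  rcases isParent_eq_or h with rfl | ⟨hj, rfl⟩ <;> rcases isParent_eq_or h' with rfl | ⟨hj', rfl⟩
  · rfl
  · simp only [latticeHeight_sub_single, latticeHeight_brunLin, hj'] at hf hf'
    linarith
  · simp only [latticeHeight_sub_single, latticeHeight_brunLin, hj] at hf hf'
    linarith
  · rfl

/-- The incidence matrix is invertible over the integers, and every letter other than `brunFirst d`
ends some image word. -/
theorem exists_isParent_right (d : BrunDigit) (f : Face) : ∃ g, IsParent d f g := by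
  have hlin : ∀ y : Fin 3 → ℤ, ∃ x, y = brunLin d x := fun y =>
    ⟨_, (eq_incidence_inv_mulVec_iff d _ y).1 rfl⟩
  by_cases hf : f.type = brunFirst d
  · obtain ⟨x, hx⟩ := hlin (f.vec + Pi.single (brunLast d 2) 1)
    exact ⟨⟨x, 2⟩, isParent_iff.2 (Or.inr ⟨rfl, hf, hx⟩)⟩
  · obtain ⟨x, hx⟩ := hlin f.vec
    obtain ⟨j, hj⟩ : ∃ j, f.type = brunLast d j := by
      generalize f.type = t at hf
      revert t
      cases d <;> decide
    exact ⟨⟨x, j⟩, isParent_iff.2 (Or.inl ⟨hj, hx⟩)⟩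

end Parents

/-! ### The patterns generated from the lower half cube -/

theorem mem_brunPattern_succ {i : ℕ → BrunDigit} {n : ℕ} {g : Face} :
    g ∈ brunPattern i (n + 1) ↔
      ∃ f ∈ brunPattern (fun k => i (k + 1)) n, IsParent (i 0) f g :=
  Substitution.mem_dual

theorem exists_mem_lowerHalfCube_isParent (d : BrunDigit) {g : Face} (hg : g ∈ lowerHalfCube) :
    ∃ f ∈ lowerHalfCube, IsParent d f g := by
  refine ⟨_, ?_, isParent_last d g⟩
  have hg : g.vec = 0 := hg
  change brunLin d g.vec = 0
  rw [hg]
  cases d <;> simp [brunLin]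

theorem brunPattern_subset_succ (i : ℕ → BrunDigit) (n : ℕ) :
    brunPattern i n ⊆ brunPattern i (n + 1) := by
  induction n generalizing i with
  | zero =>
    intro g hg
    exact mem_brunPattern_succ.2 (exists_mem_lowerHalfCube_isParent _ hg)
  | succ n ih =>
    intro g hg
    obtain ⟨f, hf, h⟩ := mem_brunPattern_succ.1 hg
    exact mem_brunPattern_succ.2 ⟨f, ih _ hf, h⟩

theorem brunPattern_subset_discretePlane {v : Fin 3 → ℝ} (hv : IsBrunGeneric v) (n : ℕ) :
    brunPattern (brunExpansion v) n ⊆ discretePlane v := by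
  induction n generalizing v with
  | zero => exact lowerHalfCube_subset_discretePlane hv.pos
  | succ n ih =>
    intro g hg
    obtain ⟨f, hf, h⟩ := mem_brunPattern_succ.1 hg
    exact mem_discretePlane_of_isParent hv.brunStep.pos (ih hv.brunStep hf) h

theorem IsParent.mem_brunPattern_iff {v : Fin 3 → ℝ} (hv : IsBrunGeneric v) {f g : Face}
    (hf : f ∈ discretePlane (brunStep v)) (h : IsParent (brunDigit v) f g) (n : ℕ) :
    g ∈ brunPattern (brunExpansion v) (n + 1) ↔ f ∈ brunPattern (brunExpansion (brunStep v)) n := by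
  constructor
  · intro hg
    obtain ⟨f', hf', h'⟩ := mem_brunPattern_succ.1 hg
    rw [isParent_unique hf (brunPattern_subset_discretePlane hv.brunStep n hf') h h']
    exact hf'
  · exact fun hf' => mem_brunPattern_succ.2 ⟨f, hf', h⟩

theorem exists_mem_brunPattern_succ_notMem {v : Fin 3 → ℝ} (hv : IsBrunGeneric v) (n : ℕ) :
    ∃ g ∈ brunPattern (brunExpansion v) (n + 1), g ∉ brunPattern (brunExpansion v) n := by
  induction n generalizing v with
  | zero =>
    -- The new face is the type `2` child, through the first letter, of a face of the half cube; its
    -- vector is nonzero.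
    obtain ⟨x, hx⟩ : ∃ x, Pi.single (brunLast (brunDigit v) 2) 1 = brunLin (brunDigit v) x :=
      ⟨_, (eq_incidence_inv_mulVec_iff _ _ _).1 rfl⟩
    refine ⟨⟨x, 2⟩, mem_brunPattern_succ.2 ⟨⟨0, brunFirst (brunDigit v)⟩, rfl,
      isParent_iff.2 (Or.inr ⟨rfl, rfl, ?_⟩)⟩, ?_⟩
    · exact (zero_add _).trans hx
    · intro h
      have h : x = 0 := h
      have hz : brunLin (brunDigit v) 0 = 0 := by
        cases brunDigit v <;> simp [brunLin]
      rw [h, hz] at hx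
      simpa using congrFun hx (brunLast (brunDigit v) 2)
  | succ n ih =>
    obtain ⟨f, hf, hf'⟩ := ih hv.brunStep
    obtain ⟨g, hg⟩ := exists_isParent_right (brunDigit v) f
    have hmem := brunPattern_subset_discretePlane hv.brunStep _ hf
    exact ⟨g, (hg.mem_brunPattern_iff hv hmem _).2 hf,
      fun h => hf' ((hg.mem_brunPattern_iff hv hmem _).1 h)⟩

theorem region_iUnion {ι : Sort*} (S : ι → Set Face) : region (⋃ n, S n) = ⋃ n, region (S n) := by
  simp only [region, Set.biUnion_iUnion]

theorem region_ssubset_region_iff {S T : Set Face} : region S ⊂ region T ↔ S ⊂ T := by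
  simp only [ssubset_iff_subset_not_subset, region_subset_region_iff]

theorem strictMono_region_brunPattern {v : Fin 3 → ℝ} (hv : IsBrunGeneric v) :
    StrictMono fun n => region (brunPattern (brunExpansion v) n) := by
  refine strictMono_nat_of_lt_succ fun n => region_ssubset_region_iff.2 ?_
  obtain ⟨g, hg, hg'⟩ := exists_mem_brunPattern_succ_notMem hv n
  exact ⟨brunPattern_subset_succ _ n, fun h => hg' (h hg)⟩

/-! ### Chains of ancestors -/

/-- A sequence of faces of the discrete planes of the Brun iterates of `v`, each of which is a
parent of the preceding one. -/
structure IsAncestry (v : Fin 3 → ℝ) (F : ℕ → Face) : Prop where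
  mem : ∀ n, F n ∈ discretePlane (brunStep^[n] v)
  isParent : ∀ n, IsParent (brunExpansion v n) (F (n + 1)) (F n)

theorem exists_isAncestry {v : Fin 3 → ℝ} {f : Face} (hf : f ∈ discretePlane v) :
    ∃ F, F 0 = f ∧ IsAncestry v F := by
  choose p hp hp' using fun (w : Fin 3 → ℝ) (g : Face) (hg : g ∈ discretePlane w) =>
    exists_isParent_mem_discretePlane hg
  let G : ∀ n, {g // g ∈ discretePlane (brunStep^[n] v)} := fun n =>
    Nat.rec ⟨f, hf⟩ (fun n g => ⟨p _ g.1 g.2, by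
      rw [Function.iterate_succ_apply']
      exact hp _ g.1 g.2⟩) n
  exact ⟨fun n => (G n).1, rfl, fun n => (G n).2, fun n => hp' _ (G n).1 (G n).2⟩

namespace IsAncestry

variable {v : Fin 3 → ℝ} {F : ℕ → Face}

theorem shift (h : IsAncestry v F) (k : ℕ) :
    IsAncestry (brunStep^[k] v) fun n => F (n + k) where
  mem n := by
    rw [← Function.iterate_add_apply]
    exact h.mem (n + k)
  isParent n := by
    have := h.isParent (n + k)
    rw [brunExpansion, Function.iterate_add_apply] at this
    rw [Nat.add_right_comm]
    exact this

theorem mem_brunPattern_iff (h : IsAncestry v F) (hv : IsBrunGeneric v) (n : ℕ) :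
    F 0 ∈ brunPattern (brunExpansion v) n ↔ F n ∈ lowerHalfCube := by
  induction n generalizing v F with
  | zero => rfl
  | succ n ih =>
    rw [(h.isParent 0).mem_brunPattern_iff hv (h.mem 1)]
    exact ih (h.shift 1) hv.brunStep

theorem mem_lowerHalfCube_of_le (h : IsAncestry v F) (hv : IsBrunGeneric v) {m n : ℕ}
    (hmn : m ≤ n) (hm : F m ∈ lowerHalfCube) : F n ∈ lowerHalfCube := by
  rw [← h.mem_brunPattern_iff hv] at hm ⊢
  exact monotone_nat_of_le_succ (brunPattern_subset_succ _) hmn hm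

end IsAncestry

/-- Some face of the discrete plane of `v` belongs to none of the patterns generated by the
expansion of `v`. -/
def HasUncoveredFace (v : Fin 3 → ℝ) : Prop :=
  ∃ f ∈ discretePlane v, ∀ n, f ∉ brunPattern (brunExpansion v) n

theorem HasUncoveredFace.of_brunStep {v : Fin 3 → ℝ} (hv : IsBrunGeneric v)
    (h : HasUncoveredFace (brunStep v)) : HasUncoveredFace v := by
  obtain ⟨f, hf, hn⟩ := h
  obtain ⟨g, hg⟩ := exists_isParent_right (brunDigit v) f
  exact ⟨g, mem_discretePlane_of_isParent hv.brunStep.pos hf hg, fun n hgn =>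
    hn n ((hg.mem_brunPattern_iff hv hf n).1 (brunPattern_subset_succ _ n hgn))⟩

theorem HasUncoveredFace.of_iterate {v : Fin 3 → ℝ} (hv : IsBrunGeneric v) {k : ℕ}
    (h : HasUncoveredFace (brunStep^[k] v)) : HasUncoveredFace v := by
  induction k with
  | zero => exact h
  | succ k ih =>
    rw [Function.iterate_succ_apply'] at h
    exact ih (h.of_brunStep (hv.iterate k))

theorem iUnion_region_brunPattern_ssubset_iff {v : Fin 3 → ℝ} (hv : IsBrunGeneric v) :
    (⋃ n, region (brunPattern (brunExpansion v) n)) ⊂ region (discretePlane v) ↔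
      HasUncoveredFace v := by
  rw [← region_iUnion, region_ssubset_region_iff, ssubset_iff_subset_not_subset, Set.not_subset,
    and_iff_right (Set.iUnion_subset fun n => brunPattern_subset_discretePlane hv n)]
  simp [HasUncoveredFace]

/-! ### Adjacent faces -/

/-- The height is the combination of the three tail sums with coefficients `v 0`, `v 1 - v 0`, `v 2
- v 1`, all positive. The conclusion no longer involves `v`, so later case analyses are purely
integral. -/
theorem tail_sum_pos_of_nonneg {v : Fin 3 → ℝ} (hv : IsBrunGeneric v) {x : Fin 3 → ℤ}
    (hx : 0 ≤ latticeHeight x v) (hx0 : x ≠ 0) :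
    0 < x 0 + x 1 + x 2 ∨ 0 < x 1 + x 2 ∨ 0 < x 2 := by
  by_contra! h
  obtain ⟨h0, h1, h2⟩ := h
  have h0' : (x 0 + x 1 + x 2 : ℝ) ≤ 0 := by exact_mod_cast h0
  have h1' : (x 1 + x 2 : ℝ) ≤ 0 := by exact_mod_cast h1
  have h2' : (x 2 : ℝ) ≤ 0 := by exact_mod_cast h2
  have e0 := mul_nonpos_of_nonpos_of_nonneg h0' hv.zero_pos.le
  have e1 := mul_nonpos_of_nonpos_of_nonneg h1' (sub_nonneg.2 hv.zero_lt_one.le)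
  have e2 := mul_nonpos_of_nonpos_of_nonneg h2' (sub_nonneg.2 hv.one_lt_two.le)
  have : latticeHeight x v = (x 0 + x 1 + x 2 : ℝ) * v 0 + (x 1 + x 2 : ℝ) * (v 1 - v 0) +
      (x 2 : ℝ) * (v 2 - v 1) := by
    rw [latticeHeight]
    ring
  have z2 : (x 2 : ℝ) = 0 :=
    (mul_eq_zero.1 (by linarith : (x 2 : ℝ) * (v 2 - v 1) = 0)).resolve_right
      (sub_pos.2 hv.one_lt_two).ne'
  have z1 : (x 1 + x 2 : ℝ) = 0 :=
    (mul_eq_zero.1 (by linarith : (x 1 + x 2 : ℝ) * (v 1 - v 0) = 0)).resolve_right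
      (sub_pos.2 hv.zero_lt_one).ne'
  have z0 : (x 0 + x 1 + x 2 : ℝ) = 0 :=
    (mul_eq_zero.1 (by linarith : (x 0 + x 1 + x 2 : ℝ) * v 0 = 0)).resolve_right hv.zero_pos.ne'
  norm_cast at z0 z1 z2
  exact hx0 (by funext j; fin_cases j <;> simp <;> omega)

theorem tail_sum_pos_of_pos {v : Fin 3 → ℝ} (hv : IsBrunGeneric v) {x : Fin 3 → ℤ}
    (hx : 0 < latticeHeight x v) : 0 < x 0 + x 1 + x 2 ∨ 0 < x 1 + x 2 ∨ 0 < x 2 :=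
  tail_sum_pos_of_nonneg hv hx.le fun h => by simp [h, latticeHeight] at hx

theorem tail_sum_pos_of_mem_discretePlane {v : Fin 3 → ℝ} (hv : IsBrunGeneric v) {f g : Face}
    (hf : f ∈ discretePlane v) (hg : g ∈ discretePlane v) {x : Fin 3 → ℤ}
    (hx : x = g.vec - f.vec + Pi.single f.type 1) :
    0 < x 0 + x 1 + x 2 ∨ 0 < x 1 + x 2 ∨ 0 < x 2 := by
  refine tail_sum_pos_of_pos hv ?_
  have : latticeHeight x v = latticeHeight g.vec v - latticeHeight f.vec v + v f.type := by
    rw [hx]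
    generalize f.type = t
    fin_cases t <;> simp [latticeHeight] <;> ring
  rw [mem_discretePlane_iff_latticeHeight] at hf hg
  linarith

/-- Two faces are adjacent if the entries of their vectors differ by at most one. -/
def Face.Adjacent (f g : Face) : Prop := ∀ j, f.vec j ≤ g.vec j + 1 ∧ g.vec j ≤ f.vec j + 1

theorem Face.Adjacent.symm {f g : Face} (h : f.Adjacent g) : g.Adjacent f :=
  fun j => (h j).symm

-- The linear map alone could enlarge the distance. The tail-sum inequalities, valid because both
-- parents lie in one discrete plane, rule this out.
set_option maxHeartbeats 1000000 in
theorem Face.Adjacent.parent_le {v : Fin 3 → ℝ} (hv : IsBrunGeneric v) {d : BrunDigit}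
    {f g f' g' : Face} (h : f.Adjacent g) (hf : IsParent d f' f) (hg : IsParent d g' g)
    (hf' : f' ∈ discretePlane v) (hg' : g' ∈ discretePlane v) :
    f'.vec 0 ≤ g'.vec 0 + 1 ∧ f'.vec 1 ≤ g'.vec 1 + 1 ∧ f'.vec 2 ≤ g'.vec 2 + 1 := by
  have hA := tail_sum_pos_of_mem_discretePlane hv hf' hg' rfl
  have hB := tail_sum_pos_of_mem_discretePlane hv hg' hf' rfl
  have h0 := h 0
  have h1 := h 1
  have h2 := h 2
  clear h
  obtain ⟨x, s⟩ := f
  obtain ⟨y, t⟩ := g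
  cases d <;>
  rcases isParent_eq_or hf with rfl | ⟨rfl, rfl⟩ <;>
  rcases isParent_eq_or hg with rfl | ⟨rfl, rfl⟩ <;>
  -- A parent through the first letter forces the child to have type `2`, so only the remaining
  -- types are enumerated.
  [(fin_cases s <;> fin_cases t); fin_cases s; fin_cases t; skip;
   (fin_cases s <;> fin_cases t); fin_cases s; fin_cases t; skip;
   (fin_cases s <;> fin_cases t); fin_cases s; fin_cases t; skip] <;>
  clear hf hg hf' hg' <;> simp only [Pi.add_apply, Pi.sub_apply] at hA hB ⊢ <;>
  simp [brunLin, brunLast, brunFirst] at hA hB h0 h1 h2 ⊢ <;> omega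

theorem Face.Adjacent.parent {v : Fin 3 → ℝ} (hv : IsBrunGeneric v) {d : BrunDigit}
    {f g f' g' : Face} (h : f.Adjacent g) (hf : IsParent d f' f) (hg : IsParent d g' g)
    (hf' : f' ∈ discretePlane v) (hg' : g' ∈ discretePlane v) : f'.Adjacent g' := by
  obtain ⟨a0, a1, a2⟩ := h.parent_le hv hf hg hf' hg'
  obtain ⟨b0, b1, b2⟩ := h.symm.parent_le hv hg hf hg' hf'
  intro j
  fin_cases j
  exacts [⟨a0, b0⟩, ⟨a1, b1⟩, ⟨a2, b2⟩]

theorem IsAncestry.adjacent {v : Fin 3 → ℝ} (hv : IsBrunGeneric v) {F G : ℕ → Face}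
    (hF : IsAncestry v F) (hG : IsAncestry v G) (h : (F 0).Adjacent (G 0)) (n : ℕ) :
    (F n).Adjacent (G n) := by
  induction n with
  | zero => exact h
  | succ n ih =>
    exact ih.parent (hv.iterate (n + 1)) (hF.isParent n) (hG.isParent n) (hF.mem _) (hG.mem _)

/-! ### Connectedness of discrete planes -/

/-- The face of type `2` of a discrete plane above a point of the horizontal integer plane. -/
noncomputable def topFace (v : Fin 3 → ℝ) (m n : ℤ) : Face :=
  ⟨![m, n, -⌊(m * v 0 + n * v 1) / v 2⌋], 2⟩

theorem topFace_zero_zero (v : Fin 3 → ℝ) : topFace v 0 0 ∈ lowerHalfCube := by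
  change (topFace v 0 0).vec = 0
  funext j
  fin_cases j <;> simp [topFace]

theorem topFace_mem_discretePlane {v : Fin 3 → ℝ} (hv : IsBrunGeneric v) (m n : ℤ) :
    topFace v m n ∈ discretePlane v := by
  have h2 := hv.pos 2
  have hl := (le_div_iff₀ h2).1 (Int.floor_le ((m * v 0 + n * v 1) / v 2))
  have hu := (div_lt_iff₀ h2).1 (Int.lt_floor_add_one ((m * v 0 + n * v 1) / v 2))
  simp only [mem_discretePlane, topFace, Matrix.cons_val]
  push_cast
  constructor <;> linarith

theorem Int.floor_add_le_and_le {R : Type*} [Ring R] [LinearOrder R] [IsStrictOrderedRing R]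
    [FloorRing R] (a : R) {b : R} (h0 : 0 ≤ b) (h1 : b ≤ 1) :
    ⌊a⌋ ≤ ⌊a + b⌋ ∧ ⌊a + b⌋ ≤ ⌊a⌋ + 1 := by
  refine ⟨Int.floor_le_floor (by simpa using h0), ?_⟩
  rw [← Int.floor_add_one]
  exact Int.floor_le_floor (by gcongr)

theorem topFace_adjacent_add_one_left {v : Fin 3 → ℝ} (hv : IsBrunGeneric v) (m n : ℤ) :
    (topFace v m n).Adjacent (topFace v (m + 1) n) := by
  have h0 := hv.zero_pos
  have h1 := hv.zero_lt_one
  have h2 := hv.one_lt_two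
  have hf := Int.floor_add_le_and_le ((m * v 0 + n * v 1) / v 2) (b := v 0 / v 2)
    (div_nonneg (by linarith) (by linarith)) ((div_le_one (by linarith)).2 (by linarith))
  rw [← add_div, show m * v 0 + n * v 1 + v 0 = ((m + 1 : ℤ) : ℝ) * v 0 + n * v 1 by
    push_cast; ring] at hf
  intro j
  fin_cases j <;> simp [topFace] <;> push_cast at hf <;> omega

theorem topFace_adjacent_add_one_right {v : Fin 3 → ℝ} (hv : IsBrunGeneric v) (m n : ℤ) :
    (topFace v m n).Adjacent (topFace v m (n + 1)) := by
  have h0 := hv.zero_pos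
  have h1 := hv.zero_lt_one
  have h2 := hv.one_lt_two
  have hf := Int.floor_add_le_and_le ((m * v 0 + n * v 1) / v 2) (b := v 1 / v 2)
    (div_nonneg (by linarith) (by linarith)) ((div_le_one (by linarith)).2 h2.le)
  rw [← add_div, show m * v 0 + n * v 1 + v 1 = (m : ℝ) * v 0 + ((n + 1 : ℤ) : ℝ) * v 1 by
    push_cast; ring] at hf
  intro j
  fin_cases j <;> simp [topFace] <;> push_cast at hf <;> omega

theorem adjacent_topFace {v : Fin 3 → ℝ} (hv : IsBrunGeneric v) {f : Face}
    (hf : f ∈ discretePlane v) : (topFace v (f.vec 0) (f.vec 1)).Adjacent f := by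
  have h0 := hv.zero_pos
  have h1 := hv.zero_lt_one
  have h2 := hv.one_lt_two
  have htype : v f.type ≤ v 2 := by
    generalize f.type = t
    fin_cases t <;> simp <;> linarith
  rw [mem_discretePlane] at hf
  -- Since `v 2` is the largest entry, the height of `f` lies in `[0, v 2)`, so `f` has the same
  -- vector as the top face.
  have hfl : ⌊(f.vec 0 * v 0 + f.vec 1 * v 1) / v 2⌋ = -f.vec 2 := by
    rw [Int.floor_eq_iff, le_div_iff₀ (by linarith), div_lt_iff₀ (by linarith)]
    push_cast
    constructor <;> linarith
  intro j
  fin_cases j <;> simp [topFace, hfl]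

/-- A property of faces of a discrete plane which holds on the lower half cube and passes to
adjacent faces holds everywhere. -/
theorem discretePlane_adjacent_induction {v : Fin 3 → ℝ} (hv : IsBrunGeneric v) {p : Face → Prop}
    (hU : ∀ f ∈ lowerHalfCube, p f)
    (hadj : ∀ f ∈ discretePlane v, ∀ g ∈ discretePlane v, f.Adjacent g → p f → p g) {f : Face}
    (hf : f ∈ discretePlane v) : p f := by
  have hmem := topFace_mem_discretePlane hv
  have hrow : ∀ m, p (topFace v m 0) := by
    intro m
    induction m using Int.induction_on with
    | zero => exact hU _ (topFace_zero_zero v)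
    | succ m ih => exact hadj _ (hmem _ _) _ (hmem _ _) (topFace_adjacent_add_one_left hv _ _) ih
    | pred m ih =>
      refine hadj _ (hmem _ _) _ (hmem _ _) ?_ ih
      simpa using (topFace_adjacent_add_one_left hv (-(m : ℤ) - 1) 0).symm
  have hall : ∀ m n, p (topFace v m n) := by
    intro m n
    induction n using Int.induction_on with
    | zero => exact hrow m
    | succ n ih => exact hadj _ (hmem _ _) _ (hmem _ _) (topFace_adjacent_add_one_right hv _ _) ih
    | pred n ih =>
      refine hadj _ (hmem _ _) _ (hmem _ _) ?_ ih
      simpa using (topFace_adjacent_add_one_right hv m (-(n : ℤ) - 1)).symm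
  exact hadj _ (hmem _ _) _ hf (adjacent_topFace hv hf) (hall _ _)

/-- If some face is not covered, then some chain of ancestors stays next to the origin without
ever being in the lower half cube. -/
theorem HasUncoveredFace.exists_bounded_isAncestry {v : Fin 3 → ℝ} (hv : IsBrunGeneric v)
    (h : HasUncoveredFace v) : ∃ k F, IsAncestry (brunStep^[k] v) F ∧
      ∀ n, F n ∉ lowerHalfCube ∧ ∀ j, -1 ≤ (F n).vec j ∧ (F n).vec j ≤ 1 := by
  obtain ⟨f₀, hf₀, hunc⟩ := h
  by_contra! hno
  have key : ∃ n, f₀ ∈ brunPattern (brunExpansion v) n := by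
    refine discretePlane_adjacent_induction hv
      (p := fun f => ∃ n, f ∈ brunPattern (brunExpansion v) n) (fun f hf => ⟨0, hf⟩) ?_ hf₀
    rintro f hf g hg hfg ⟨k, hk⟩
    by_contra! hgn
    obtain ⟨F, rfl, hF⟩ := exists_isAncestry hf
    obtain ⟨G, rfl, hG⟩ := exists_isAncestry hg
    rw [hF.mem_brunPattern_iff hv] at hk
    obtain ⟨n, hn⟩ := hno k _ (hG.shift k)
    obtain ⟨j, hj⟩ := hn ((hG.mem_brunPattern_iff hv _).not.1 (hgn (n + k)))
    -- From time `k` on the ancestors of `f` sit at the origin, which confines those of `g`.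
    have hz : (F (n + k)).vec = 0 := hF.mem_lowerHalfCube_of_le hv (Nat.le_add_left k n) hk
    have := hF.adjacent hv hG hfg (n + k) j
    rw [hz, Pi.zero_apply] at this
    have := hj (by omega)
    omega
  obtain ⟨n, hn⟩ := key
  exact hunc n hn

/-! ### Bounded chains of ancestors and the four-vertex graph -/

theorem tail_sum_conditions {v : Fin 3 → ℝ} (hv : IsBrunGeneric v) {f : Face}
    (hf : f ∈ discretePlane v) (hU : f ∉ lowerHalfCube) :
    (0 < f.vec 0 + f.vec 1 + f.vec 2 ∨ 0 < f.vec 1 + f.vec 2 ∨ 0 < f.vec 2) ∧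
      (f.type = 0 → f.vec 0 + f.vec 1 + f.vec 2 < 1 ∨ f.vec 1 + f.vec 2 < 0 ∨ f.vec 2 < 0) ∧
      (f.type = 1 → f.vec 0 + f.vec 1 + f.vec 2 < 1 ∨ f.vec 1 + f.vec 2 < 1 ∨ f.vec 2 < 0) ∧
      (f.type = 2 → f.vec 0 + f.vec 1 + f.vec 2 < 1 ∨ f.vec 1 + f.vec 2 < 1 ∨ f.vec 2 < 1) := by
  refine ⟨tail_sum_pos_of_nonneg hv (mem_discretePlane_iff_latticeHeight.1 hf).1 hU, ?_⟩
  have h := tail_sum_pos_of_mem_discretePlane hv hf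
    (lowerHalfCube_subset_discretePlane hv.pos (rfl : (⟨0, 0⟩ : Face) ∈ lowerHalfCube)) rfl
  refine ⟨?_, ?_, ?_⟩ <;> intro ht <;> rw [ht] at h <;>
    simp only [Pi.add_apply, Pi.sub_apply] at h <;> simp at h <;> omega

/-- The vectors next to the origin from which a chain of ancestors avoiding the lower half cube
meets only finitely many digits `3`. -/
def IsTransient (x : Fin 3 → ℤ) : Prop :=
  (x 0 = 0 ∧ x 1 = -1 ∧ x 2 = 1) ∨ (x 0 = 1 ∧ 0 ≤ x 1 ∧ x 2 = 0) ∨ (x 0 = 0 ∧ x 1 = 1 ∧ x 2 = 0)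

/-- A vertex of the four-vertex graph sits at certain vectors next to the origin. -/
def BrunVertex.IsAt : BrunVertex → (Fin 3 → ℤ) → Prop
  | .a, x => x 0 = 1 ∧ x 1 = 1 ∧ x 2 = -1
  | .b, x => x 0 = 1 ∧ x 1 = -1 ∧ x 2 = 1
  | .c, x => x 0 = -1 ∧ x 1 = 1 ∧ x 2 = 0
  | .d, x => x 0 = -1 ∧ x 1 ≤ 0 ∧ x 2 = 1

/-- A face off the lower half cube which is next to the origin and in the discrete plane of some
vector with an admissible Brun expansion. -/
def IsNearFace (f : Face) : Prop :=
  f ∉ lowerHalfCube ∧ (∀ j, -1 ≤ f.vec j ∧ f.vec j ≤ 1) ∧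
    ∃ v, IsBrunGeneric v ∧ f ∈ discretePlane v

theorem IsNearFace.isTransient_or_exists_isAt {f : Face} (h : IsNearFace f) :
    IsTransient f.vec ∨ ∃ w : BrunVertex, w.IsAt f.vec := by
  obtain ⟨hU, hb, v, hv, hf⟩ := h
  obtain ⟨hA, hB⟩ := tail_sum_conditions hv hf hU
  have h0 : f.vec 0 = -1 ∨ f.vec 0 = 0 ∨ f.vec 0 = 1 := by have := hb 0; omega
  have h1 : f.vec 1 = -1 ∨ f.vec 1 = 0 ∨ f.vec 1 = 1 := by have := hb 1; omega
  have h2 : f.vec 2 = -1 ∨ f.vec 2 = 0 ∨ f.vec 2 = 1 := by have := hb 2; omega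
  have ht : f.type = 0 ∨ f.type = 1 ∨ f.type = 2 := by
    generalize f.type = t
    revert t
    decide
  by_contra! hno
  obtain ⟨hT, hw⟩ := hno
  have ha := hw .a
  have hb := hw .b
  have hc := hw .c
  have hd := hw .d
  simp only [IsTransient, BrunVertex.IsAt] at hT ha hb hc hd
  rcases h0 with h0 | h0 | h0 <;> rcases h1 with h1 | h1 | h1 <;> rcases h2 with h2 | h2 | h2 <;>
    simp [h0, h1, h2] at hA hB hT ha hb hc hd <;> rcases ht with ht | ht | ht <;> simp [ht] at hB

/-- The potential `x 0 + 2 * x 2` equals `2`, `1`, `0` on the three kinds of transient vectors, so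
it can drop only finitely often. -/
theorem IsTransient.step {f g : Face} (hg : IsTransient g.vec) (hgn : IsNearFace g)
    (hf : IsNearFace f) {d : BrunDigit} (h : IsParent d f g) :
    IsTransient f.vec ∧ f.vec 0 + 2 * f.vec 2 ≤ g.vec 0 + 2 * g.vec 2 ∧
      (d = .three → f.vec 0 + 2 * f.vec 2 < g.vec 0 + 2 * g.vec 2) := by
  obtain ⟨hU, hb, v, hv, hfv⟩ := hf
  obtain ⟨hA, hB⟩ := tail_sum_conditions hv hfv hU
  have h0 := hb 0
  have h1 := hb 1
  have h2 := hb 2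
  obtain ⟨hU', hb', v', hv', hgv⟩ := hgn
  obtain ⟨hA', hB'⟩ := tail_sum_conditions hv' hgv hU'
  have h1' := hb' 1
  clear hb hb' hfv hgv hU hU'
  obtain ⟨y, s⟩ := g
  rcases isParent_eq_or h with rfl | ⟨rfl, rfl⟩ <;> cases d <;> [fin_cases s; fin_cases s;
    fin_cases s; skip; skip; skip] <;> clear h <;> rcases hg with hg | hg | hg <;>
    simp only [Pi.sub_apply, IsTransient] at * <;>
    simp [brunLin, brunLast, brunFirst] at hA hB hA' hB' h0 h1 h2 h1' hg ⊢ <;> omega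

set_option maxHeartbeats 1000000 in
theorem BrunVertex.IsAt.brunEdge {f g : Face} {w w' : BrunVertex} (hw : w.IsAt g.vec)
    (hw' : w'.IsAt f.vec) (hg : IsNearFace g) (hf : IsNearFace f) {d : BrunDigit}
    (h : IsParent d f g) : BrunEdge w' d w := by
  obtain ⟨hU, hb, v, hv, hfv⟩ := hf
  obtain ⟨hA, hB⟩ := tail_sum_conditions hv hfv hU
  obtain ⟨hU', hb', v', hv', hgv⟩ := hg
  obtain ⟨hA', hB'⟩ := tail_sum_conditions hv' hgv hU'
  have h1 := hb 1
  have h1' := hb' 1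
  clear hb hb' hfv hgv hU hU'
  obtain ⟨y, s⟩ := g
  -- Each triple either is an edge of the graph or contradicts the parent equations and the tail-sum
  -- inequalities.
  cases w <;> cases w' <;> cases d <;> first
  | constructor
  | exfalso
    rcases isParent_eq_or h with rfl | ⟨rfl, rfl⟩ <;> [fin_cases s; skip] <;> clear h <;>
    simp only [Pi.sub_apply, BrunVertex.IsAt] at * <;>
    simp [brunLin, brunLast, brunFirst] at hA hB hA' hB' h1 h1' hw hw' <;> omega

theorem IsAncestry.not_isTransient {v : Fin 3 → ℝ} (hv : IsBrunGeneric v) {F : ℕ → Face}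
    (hF : IsAncestry v F) (hnear : ∀ n, IsNearFace (F n)) (n : ℕ) : ¬ IsTransient (F n).vec := by
  have hstep := fun n hT => IsTransient.step hT (hnear n) (hnear (n + 1)) (hF.isParent n)
  have key : ∀ (r : ℕ) (n : ℕ), IsTransient (F n).vec →
      (F n).vec 0 + 2 * (F n).vec 2 < r → False := by
    intro r
    induction r with
    | zero =>
      intro n hT hr
      rcases hT with h | h | h <;> push_cast at hr <;> omega
    | succ r ih =>
      intro n hT hr
      obtain ⟨m, -, h3, hT', hr'⟩ := hv.2.exists_three_of_preserved
        (p := fun n => IsTransient (F n).vec ∧ (F n).vec 0 + 2 * (F n).vec 2 < (r + 1 : ℕ))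
        (fun n _ hn => ⟨(hstep n hn.1).1, (hstep n hn.1).2.1.trans_lt hn.2⟩) ⟨hT, hr⟩
      obtain ⟨hT'', -, hlt⟩ := hstep m hT'
      have := hlt h3
      exact ih (m + 1) hT'' (by push_cast at hr'; omega)
  intro hT
  refine key ((F n).vec 0 + 2 * (F n).vec 2 + 1).toNat n hT ?_
  have := Int.self_le_toNat ((F n).vec 0 + 2 * (F n).vec 2 + 1)
  omega

theorem IsAncestry.isBackwardLabelling {v : Fin 3 → ℝ} (hv : IsBrunGeneric v) {F : ℕ → Face}
    (hF : IsAncestry v F) (hnear : ∀ n, IsNearFace (F n)) :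
    IsBackwardLabelling (brunExpansion v) := by
  choose w hw using fun n =>
    (hnear n).isTransient_or_exists_isAt.resolve_left (hF.not_isTransient hv hnear n)
  exact ⟨w, fun n => (hw n).brunEdge (hw (n + 1)) (hnear n) (hnear (n + 1)) (hF.isParent n)⟩

/-- The vector of the faces attached to a vertex of the four-vertex graph. -/
def BrunVertex.vec : BrunVertex → Fin 3 → ℤ
  | .a => ![1, 1, -1]
  | .b => ![1, -1, 1]
  | .c => ![-1, 1, 0]
  | .d => ![-1, 0, 1]

/-- The types of the faces attached to a vertex of the four-vertex graph. -/
def BrunVertex.types : BrunVertex → List (Fin 3)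
  | .a => [0, 1]
  | .b => [2]
  | .c => [1, 2]
  | .d => [2]

/-- Faces attached to the vertices of the four-vertex graph, so that every edge is a step from a
face to a parent. -/
def BrunVertex.faces (w : BrunVertex) : Set Face := {f | f.vec = w.vec ∧ f.type ∈ w.types}

theorem BrunEdge.exists_isParent {w w' : BrunVertex} {d : BrunDigit} (h : BrunEdge w' d w)
    {g : Face} (hg : g ∈ w.faces) : ∃ f ∈ w'.faces, IsParent d f g := by
  obtain ⟨x, t⟩ := g
  obtain ⟨hx, ht⟩ := hg
  dsimp only at hx ht
  subst hx
  cases h <;> fin_cases t <;> simp [BrunVertex.types] at ht <;> first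
  | refine ⟨_, ?_, isParent_last _ _⟩
    constructor
    · funext j
      fin_cases j <;> simp [BrunVertex.vec, brunLin]
    · simp [BrunVertex.types, brunLast]
  | refine ⟨_, ?_, isParent_first _ rfl⟩
    constructor
    · funext j
      fin_cases j <;> simp [BrunVertex.vec, brunLin, brunLast]
    · simp [BrunVertex.types, brunFirst]

theorem BrunVertex.mem_discretePlane_of_mem_faces {v : Fin 3 → ℝ} (hv : IsBrunGeneric v)
    {w w' : BrunVertex} (h : BrunEdge w' (brunDigit v) w) {f : Face} (hf : f ∈ w.faces) :
    f ∈ discretePlane v := by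
  have h0 := hv.zero_pos
  have h1 := hv.zero_lt_one
  have h2 := hv.one_lt_two
  obtain ⟨x, t⟩ := f
  obtain ⟨hx, ht⟩ := hf
  dsimp only at hx ht
  subst hx
  rw [mem_discretePlane]
  cases w
  -- The only edge ending at `a` has label `3`, and that case of the algorithm makes the height of
  -- `(1, 1, -1)` positive. The other vertices need only the strict ordering.
  · have h3 : v 2 - v 1 < v 0 := by
      generalize hd : brunDigit v = d at h
      cases h
      unfold brunDigit at hd
      split_ifs at hd with _ hlt
      exact not_le.1 hlt
    fin_cases t <;> simp [types, vec] at ht ⊢ <;> constructor <;> linarith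
  all_goals fin_cases t <;> simp [types, vec] at ht ⊢ <;> (try constructor) <;> linarith

theorem BrunVertex.notMem_lowerHalfCube {w : BrunVertex} {f : Face} (hf : f ∈ w.faces) :
    f ∉ lowerHalfCube := by
  intro h0
  have h0 : f.vec = 0 := h0
  cases w <;> simpa [h0, vec] using congrFun hf.1 0

theorem IsBackwardLabelling.hasUncoveredFace {v : Fin 3 → ℝ} (hv : IsBrunGeneric v)
    (h : IsBackwardLabelling (brunExpansion v)) : HasUncoveredFace v := by
  obtain ⟨w, hw⟩ := h
  choose p hp hp' using fun n (g : Face) (hg : g ∈ (w n).faces) => (hw n).exists_isParent hg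
  obtain ⟨f₀, hf₀⟩ : (w 0).faces.Nonempty := by
    refine ⟨⟨(w 0).vec, (w 0).types.headI⟩, rfl, ?_⟩
    cases w 0 <;> decide
  let G : ∀ n, {g // g ∈ (w n).faces} := fun n =>
    Nat.rec ⟨f₀, hf₀⟩ (fun n g => ⟨p n g.1 g.2, hp n g.1 g.2⟩) n
  have hG : IsAncestry v fun n => (G n).1 :=
    { mem := fun n => BrunVertex.mem_discretePlane_of_mem_faces (hv.iterate n) (hw n) (G n).2
      isParent := fun n => hp' n (G n).1 (G n).2 }
  exact ⟨_, hG.mem 0, fun n hn =>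
    BrunVertex.notMem_lowerHalfCube (G n).2 ((hG.mem_brunPattern_iff hv n).1 hn)⟩

theorem brunExpansion_iterate (v : Fin 3 → ℝ) (k : ℕ) :
    brunExpansion (brunStep^[k] v) = fun n => brunExpansion v (k + n) := by
  funext n
  rw [brunExpansion, brunExpansion, ← Function.iterate_add_apply, add_comm]

theorem hasUncoveredFace_iff {v : Fin 3 → ℝ} (hv : IsBrunGeneric v) :
    HasUncoveredFace v ↔ ∃ k, IsBackwardLabelling fun n => brunExpansion v (k + n) := by
  simp only [← brunExpansion_iterate]
  constructor
  · intro h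
    obtain ⟨k, F, hF, hnear⟩ := h.exists_bounded_isAncestry hv
    exact ⟨k, hF.isBackwardLabelling (hv.iterate k) fun n =>
      ⟨(hnear n).1, (hnear n).2, _, (hv.iterate k).iterate n, hF.mem n⟩⟩
  · rintro ⟨k, hk⟩
    exact (hk.hasUncoveredFace (hv.iterate k)).of_iterate hv

theorem theorem4p2 (i : ℕ → BrunDigit) (hi : BrunAdmissible i) :
    (∀ n, (brunPattern i n).Finite) ∧
    StrictMono (fun n => region (brunPattern i n)) ∧
    (∃ v : Fin 3 → ℝ, BrunOrdered v ∧ brunExpansion v = i) ∧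
    ∀ v : Fin 3 → ℝ, BrunOrdered v → brunExpansion v = i →
      (∀ j, 0 < v j) ∧
      (∀ n, region (brunPattern i n) ⊆ region (discretePlane v)) ∧
      ((⋃ n, region (brunPattern i n)) ⊂ region (discretePlane v) ↔
        ∃ k, IsBackwardLabelling (fun n => i (k + n))) := by
  obtain ⟨v₀, ho, rfl⟩ := exists_brunExpansion_eq hi
  refine ⟨finite_brunPattern _, strictMono_region_brunPattern ⟨ho, hi⟩, ⟨v₀, ho, rfl⟩, ?_⟩
  intro v hv he
  rw [← he] at hi ⊢
  have hgen : IsBrunGeneric v := ⟨hv, hi⟩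
  exact ⟨hgen.pos, fun n => region_subset_region_iff.2 (brunPattern_subset_discretePlane hgen n),
    (iUnion_region_brunPattern_ssubset_iff hgen).trans (hasUncoveredFace_iff hgen)⟩
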